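/- Let $t > s \ge 0$ be fixed integers. For all sufficiently large $n$ there is a family $\mathcal{F}_n \subseteq \{0,1\}^n$ of exactly $$|\mathcal{F}_n| = \left(\frac{1}{\binom{t}{s}} - o(1)\right)\binom{n}{t-s}$$ binary vectors such that any two distinct vectors of $\mathcal{F}_n$ have Hamming distance in $\{2s+1, 2s+2, \ldots, 2t\}$. Here $o(1)$ denotes a real quantity, depending only on $s,t,n$, that tends to $0$ as $n\to\infty$ with $s,t$ fixed. In particular, the upper bound $\binom{n}{t-s} + 2\sum_{i=0}^{t-s-1}\binom{n}{i}$ for the size of families in $\{0,1\}^n$ with all pairwise distances in $\{2s+1,\ldots,2t\}$ is tight up to a constant factor: there is a constant $c>0$ depending only on $s,t$ such that, for all sufficiently large $n$, $$|\mathcal{F}_n| \ge c\left(\binom{n}{t-s} + 2\sum_{i=0}^{t-s-1}\binom{n}{i}\right).$$ -/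

import Mathlib

open Filter Topology

/-- `HasDistancesIn F L`: any two distinct vectors of the family `F ⊆ {0,1}ⁿ` have their
Hamming distance in the set `L`. -/
def HasDistancesIn {n : ℕ} (F : Finset (Fin n → Bool)) (L : Set ℕ) : Prop :=
  ∀ x ∈ F, ∀ y ∈ F, x ≠ y → hammingDist x y ∈ L

/-! Distinct `t`-sets sharing fewer than `t - s` points have characteristic vectors at distance
between `2s+2` and `2t`, so a near-optimal partial Steiner system suffices. It is a packing in the
hypergraph whose vertices are the `(t-s)`-sets and whose edges are the `t`-sets: uniform, regular,
with small codegrees.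

Such hypergraphs have almost perfect packings by random greedy (`exists_almost_perfect_packing`).
Let `a S` be the probability that the packing so far misses `S`. One step changes `a` by an exact
linear rule. With `η = D / |E|`, the rule nearly preserves the form `a S = p ^ |S|`, with `p`
replaced by `p - η p ^ K`. The error is kept below `h * q ^ |S|` (`greedyStep_error`). The base `q`
grows slowly and is reset to 2 after each round by a square root (`greedyAvoidance_round`).
Boundedly many rounds bring `p` near 0, so some packing leaves few vertices uncovered. -/

/-- Indicator that a vertex set `S` misses all edges of `P`. -/
noncomputable def missIndicator {α ι : Type} [DecidableEq α] (edge : ι → Finset α)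
    (P : Finset ι) (S : Finset α) : ℝ :=
  if Disjoint S (P.biUnion edge) then 1 else 0

/-- The effect on avoidance probabilities of one step of the random greedy packing process:
draw a uniformly random edge of `E` and add it if it is disjoint from what is there. -/
noncomputable def greedyStep {α ι : Type} [DecidableEq α] (edge : ι → Finset α)
    (E : Finset ι) : (Finset α → ℝ) →ₗ[ℝ] (Finset α → ℝ) where
  toFun a S := a S - (E.card : ℝ)⁻¹ * ∑ e ∈ E with ¬ Disjoint (edge e) S, a (S ∪ edge e)
  map_add' a b := by
    funext S
    simp only [Pi.add_apply, Finset.sum_add_distrib]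
    ring
  map_smul' c a := by
    funext S
    simp only [Pi.smul_apply, smul_eq_mul, ← Finset.mul_sum, RingHom.id_apply]
    ring

/-- Packings: sets of pairwise disjoint edges. -/
def packings {α ι : Type} (edge : ι → Finset α) (E : Finset ι) : Set (Finset ι) :=
  {P | P ⊆ E ∧ (P : Set ι).PairwiseDisjoint edge}

/-- Avoidance probabilities of random packings. -/
noncomputable def avoidanceHull {α ι : Type} [DecidableEq α] (edge : ι → Finset α)
    (E : Finset ι) : Set (Finset α → ℝ) :=
  convexHull ℝ (missIndicator edge '' packings edge E)

/-! ### The greedy step as a linear map, with convex hulls in place of probability. -/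

section Greedy

variable {α ι : Type} [DecidableEq α] (edge : ι → Finset α) (E : Finset ι)

theorem greedyStep_apply (a : Finset α → ℝ) (S : Finset α) :
    greedyStep edge E a S =
      a S - (E.card : ℝ)⁻¹ * ∑ e ∈ E with ¬ Disjoint (edge e) S, a (S ∪ edge e) := rfl

/-- A missed `S` becomes hit exactly when `e` meets `S` and is accepted, that is, when `S ∪ edge e`
was missed before. Hence the recursion is linear. -/
theorem missIndicator_greedy_insert [DecidableEq ι] (P : Finset ι) (e : ι) (S : Finset α) :
    missIndicator edge (if Disjoint (edge e) (P.biUnion edge) then insert e P else P) S =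
      missIndicator edge P S -
        if ¬ Disjoint (edge e) S then missIndicator edge P (S ∪ edge e) else 0 := by
  have hc : Disjoint S (edge e) ↔ Disjoint (edge e) S := disjoint_comm
  unfold missIndicator
  by_cases h1 : Disjoint (edge e) (P.biUnion edge)
  · by_cases h2 : Disjoint (edge e) S <;> by_cases h3 : Disjoint S (P.biUnion edge) <;>
      simp [h1, h2, h3, hc,
        Finset.disjoint_union_left, Finset.disjoint_union_right, Finset.biUnion_insert]
  · simp [h1,
      Finset.disjoint_union_left]

theorem greedyStep_missIndicator [DecidableEq ι] (hE : E.Nonempty) (P : Finset ι) :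
    greedyStep edge E (missIndicator edge P) =
      ∑ e ∈ E, (E.card : ℝ)⁻¹ •
        missIndicator edge (if Disjoint (edge e) (P.biUnion edge) then insert e P else P) := by
  funext S
  have hc : (E.card : ℝ) ≠ 0 := by exact_mod_cast hE.card_pos.ne'
  rw [greedyStep_apply, Finset.sum_apply, Finset.sum_filter]
  simp only [Pi.smul_apply, smul_eq_mul, missIndicator_greedy_insert, ← Finset.mul_sum,
    Finset.sum_sub_distrib, Finset.sum_const, nsmul_eq_mul]
  field_simp

theorem greedyStep_mem_avoidanceHull (hE : E.Nonempty) {a : Finset α → ℝ}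
    (ha : a ∈ avoidanceHull edge E) : greedyStep edge E a ∈ avoidanceHull edge E := by
  classical
  have hsub : avoidanceHull edge E ⊆ greedyStep edge E ⁻¹' avoidanceHull edge E := by
    refine convexHull_min ?_ ((convex_convexHull ℝ _).linear_preimage _)
    rintro _ ⟨P, ⟨hPE, hP⟩, rfl⟩
    rw [Set.mem_preimage, greedyStep_missIndicator edge E hE]
    refine (convex_convexHull ℝ _).sum_mem (fun _ _ => by positivity) ?_ ?_
    · have hc : (E.card : ℝ) ≠ 0 := by exact_mod_cast hE.card_pos.ne'
      simp [hc]
    · intro e he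
      refine subset_convexHull ℝ _ ⟨_, ?_, rfl⟩
      split_ifs with h
      · refine ⟨Finset.insert_subset he hPE, ?_⟩
        rw [Finset.coe_insert]
        refine hP.insert fun f hf _ => ?_
        exact (Finset.disjoint_biUnion_right _ _ _).1 h f hf
      · exact ⟨hPE, hP⟩
  exact hsub ha

theorem avoidanceHull_bounds {a : Finset α → ℝ} (ha : a ∈ avoidanceHull edge E)
    (S : Finset α) : 0 ≤ a S ∧ a S ≤ 1 := by
  have hsub : avoidanceHull edge E ⊆ Set.Icc 0 1 := by
    refine convexHull_min ?_ (convex_Icc 0 1)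
    rintro _ ⟨P, -, rfl⟩
    constructor <;> intro S <;> unfold missIndicator <;> split_ifs <;> simp
  exact ⟨(hsub ha).1 S, (hsub ha).2 S⟩

theorem one_mem_avoidanceHull : (fun _ => 1) ∈ avoidanceHull edge E :=
  subset_convexHull ℝ _ ⟨∅, ⟨by simp, by simp⟩, by funext S; simp [missIndicator]⟩

/-- First-moment method: some packing does no worse than the average. -/
theorem exists_packing_sum_le {a : Finset α → ℝ} (ha : a ∈ avoidanceHull edge E)
    (X : Finset α) : ∃ P ∈ packings edge E,
      ∑ v ∈ X, missIndicator edge P {v} ≤ ∑ v ∈ X, a {v} := by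
  by_contra! h
  let f : (Finset α → ℝ) →ₗ[ℝ] ℝ := ∑ v ∈ X, LinearMap.proj {v}
  have hf : ∀ b, f b = ∑ v ∈ X, b {v} := fun b => by simp [f]
  have hsub : avoidanceHull edge E ⊆ f ⁻¹' Set.Ioi (∑ v ∈ X, a {v}) := by
    refine convexHull_min ?_ ((convex_Ioi _).linear_preimage _)
    rintro _ ⟨P, hP, rfl⟩
    rw [Set.mem_preimage, hf]
    exact h P hP
  have := hsub ha
  rw [Set.mem_preimage, hf, Set.mem_Ioi] at this
  exact lt_irrefl _ this

end Greedy

/-! ### Counting edges that meet a vertex set. -/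

/-- A `K`-uniform `D`-regular hypergraph on `X` with codegrees at most `δ * D`. -/
structure NearlyLinear {α ι : Type} [DecidableEq α] (edge : ι → Finset α) (E : Finset ι)
    (X : Finset α) (K D : ℕ) (δ : ℝ) : Prop where
  subset : ∀ e ∈ E, edge e ⊆ X
  uniform : ∀ e ∈ E, (edge e).card = K
  regular : ∀ v ∈ X, (E.filter fun e => v ∈ edge e).card = D
  codegree : ∀ u ∈ X, ∀ v ∈ X, u ≠ v →
    ((E.filter fun e => u ∈ edge e ∧ v ∈ edge e).card : ℝ) ≤ δ * D

section Count

variable {α ι : Type} [DecidableEq α] {edge : ι → Finset α} {E : Finset ι}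
  {X : Finset α} {K D : ℕ} {δ : ℝ}

theorem NearlyLinear.sum_card_inter (H : NearlyLinear edge E X K D δ) {S : Finset α}
    (hS : S ⊆ X) : ∑ e ∈ E, (edge e ∩ S).card = S.card * D := by
  have h1 : ∀ e ∈ E, (edge e ∩ S).card = ∑ v ∈ S, if v ∈ edge e then 1 else 0 := by
    intro e _
    rw [Finset.sum_boole, Finset.inter_comm, ← Finset.filter_mem_eq_inter]; simp
  rw [Finset.sum_congr rfl h1, Finset.sum_comm]
  simp only [Finset.sum_boole, Nat.cast_id]
  rw [Finset.sum_congr rfl fun v hv => H.regular v (hS hv)]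
  simp

theorem NearlyLinear.sum_card_offDiag (H : NearlyLinear edge E X K D δ) (hδ : 0 ≤ δ)
    {S : Finset α} (hS : S ⊆ X) :
    ∑ e ∈ E, ((edge e ∩ S).offDiag.card : ℝ) ≤ (S.card : ℝ) ^ 2 * (δ * D) := by
  have h1 : ∀ e ∈ E, ((edge e ∩ S).offDiag.card : ℝ) =
      ∑ x ∈ S.offDiag, if x.1 ∈ edge e ∧ x.2 ∈ edge e then 1 else 0 := by
    intro e _
    rw [Finset.sum_boole]
    congr 2
    ext ⟨u, v⟩
    simp only [Finset.mem_offDiag, Finset.mem_inter, Finset.mem_filter]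
    tauto
  rw [Finset.sum_congr rfl h1, Finset.sum_comm]
  simp only [Finset.sum_boole]
  calc _ ≤ ∑ x ∈ S.offDiag, δ * D := by
        refine Finset.sum_le_sum fun x hx => ?_
        rw [Finset.mem_offDiag] at hx
        exact H.codegree _ (hS hx.1) _ (hS hx.2.1) hx.2.2
    _ = (S.offDiag.card : ℝ) * (δ * D) := by simp
    _ ≤ _ := by
        have h3 : S.offDiag.card ≤ S.card ^ 2 := by
          rw [Finset.offDiag_card, sq]; exact Nat.sub_le _ _
        have h4 : (S.offDiag.card : ℝ) ≤ (S.card : ℝ) ^ 2 := by exact_mod_cast h3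
        gcongr

/-- The sum over the edges meeting `S` of a function close to `y` on edges meeting `S` once. -/
theorem NearlyLinear.abs_sum_sub_le (H : NearlyLinear edge E X K D δ) (hδ : 0 ≤ δ)
    {S : Finset α} (hS : S ⊆ X) {f : ι → ℝ} {y z : ℝ} (hf0 : ∀ e, 0 ≤ f e) (hf1 : ∀ e, f e ≤ 1)
    (hy0 : 0 ≤ y) (hy1 : y ≤ 1) (hz : 0 ≤ z)
    (hfy : ∀ e ∈ E, (edge e ∩ S).card = 1 → |f e - y| ≤ z) :
    |(∑ e ∈ E with ¬ Disjoint (edge e) S, f e) - S.card * D * y| ≤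
      S.card * D * z + 2 * ((S.card : ℝ) ^ 2 * (δ * D)) := by
  have h1 : (S.card : ℝ) * D = ∑ e ∈ E, ((edge e ∩ S).card : ℝ) := by
    exact_mod_cast (H.sum_card_inter hS).symm
  rw [h1, Finset.sum_filter, Finset.sum_mul, Finset.sum_mul, ← Finset.sum_sub_distrib]
  refine (Finset.abs_sum_le_sum_abs _ _).trans ?_
  refine le_trans ?_ (add_le_add le_rfl
    (mul_le_mul_of_nonneg_left (H.sum_card_offDiag hδ hS) zero_le_two))
  rw [Finset.mul_sum, ← Finset.sum_add_distrib]
  refine Finset.sum_le_sum fun e he => ?_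
  rw [Finset.offDiag_card]
  set c := (edge e ∩ S).card with hc
  rcases Nat.lt_trichotomy c 1 with h | h | h
  · have h0 : c = 0 := by omega
    have hd : Disjoint (edge e) S := by
      rw [Finset.disjoint_iff_inter_eq_empty, ← Finset.card_eq_zero, ← hc, h0]
    simp [hd, h0]
  · have hd : ¬ Disjoint (edge e) S := by
      rw [Finset.disjoint_iff_inter_eq_empty, ← Finset.card_eq_zero, ← hc, h]; simp
    simpa [hd, h] using hfy e he h
  · have hd : ¬ Disjoint (edge e) S := by
      rw [Finset.disjoint_iff_inter_eq_empty, ← Finset.card_eq_zero, ← hc]; omega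
    -- The discrepancy is at most `c ≤ c * (c - 1)`, so it is charged to ordered pairs in `edge e ∩
    -- S`.
    have hc2 : (2 : ℝ) ≤ c := by exact_mod_cast h
    have h5 : ((c * c - c : ℕ) : ℝ) = c * c - c := by
      rw [Nat.cast_sub (Nat.le_mul_self c)]; push_cast; ring
    rw [if_pos hd, h5, abs_le]
    have := hf0 e
    have := hf1 e
    have h6 : (c : ℝ) * y ≤ c := by nlinarith
    have h7 : 0 ≤ (c : ℝ) * y := by positivity
    have h8 : 0 ≤ (c : ℝ) * z := by positivity
    constructor <;> nlinarith

end Count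

/-! ### The density recursion and elementary inequalities. -/

/-- The limiting density of uncovered vertices after `k` steps of step size `η`. -/
def uncoveredDensity (K : ℕ) (η : ℝ) : ℕ → ℝ
  | 0 => 1
  | k + 1 => uncoveredDensity K η k - η * uncoveredDensity K η k ^ K

section Density

variable {K : ℕ} {η : ℝ}

theorem uncoveredDensity_bounds (hK : 1 ≤ K) (hη0 : 0 ≤ η) (hη1 : η ≤ 1) (k : ℕ) :
    0 ≤ uncoveredDensity K η k ∧ uncoveredDensity K η k ≤ 1 := by
  induction k with
  | zero => simp [uncoveredDensity]
  | succ k ih =>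
    obtain ⟨h0, h1⟩ := ih
    have h2 : uncoveredDensity K η k ^ K ≤ uncoveredDensity K η k :=
      pow_le_of_le_one h0 h1 (by omega)
    have h3 : 0 ≤ uncoveredDensity K η k ^ K := by positivity
    rw [uncoveredDensity]
    constructor <;> nlinarith

/-- While the density exceeds `ε`, each step lowers it by at least `η * ε ^ K`. -/
theorem uncoveredDensity_le (hK : 1 ≤ K) (hη0 : 0 ≤ η) (hη1 : η ≤ 1) {ε : ℝ} (hε : 0 ≤ ε)
    (k : ℕ) : uncoveredDensity K η k ≤ ε ∨ uncoveredDensity K η k ≤ 1 - k * (η * ε ^ K) := by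
  induction k with
  | zero => right; simp [uncoveredDensity]
  | succ k ih =>
    obtain ⟨h0, h1⟩ := uncoveredDensity_bounds hK hη0 hη1 k
    have h3 : 0 ≤ uncoveredDensity K η k ^ K := by positivity
    rw [uncoveredDensity]
    by_cases h : uncoveredDensity K η k ≤ ε
    · left; nlinarith
    · right
      have h4 : ε ^ K ≤ uncoveredDensity K η k ^ K := by gcongr; linarith
      have h5 := ih.resolve_left h
      have h6 : η * ε ^ K ≤ η * uncoveredDensity K η k ^ K := by gcongr
      push_cast
      linarith

end Density

theorem sq_le_two_mul_two_pow (j : ℕ) : j ^ 2 ≤ 2 * 2 ^ j := by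
  rcases Nat.lt_or_ge j 4 with h | h
  · interval_cases j <;> norm_num
  · induction j, h using Nat.le_induction with
    | base => norm_num
    | succ j hj ih => rw [pow_succ 2 j]; nlinarith

theorem one_sub_pow_bounds {x : ℝ} (h0 : 0 ≤ x) (h1 : x ≤ 1) (j : ℕ) :
    0 ≤ (1 - x) ^ j - (1 - j * x) ∧ (1 - x) ^ j - (1 - j * x) ≤ j ^ 2 * x ^ 2 := by
  induction j with
  | zero => simp
  | succ j ih =>
    obtain ⟨a, b⟩ := ih
    have hj : (0 : ℝ) ≤ j := by positivity
    have e : (1 - x) ^ (j + 1) - (1 - ((j + 1 : ℕ) : ℝ) * x) =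
        (1 - x) * ((1 - x) ^ j - (1 - j * x)) + j * x ^ 2 := by push_cast; ring
    rw [e]
    constructor
    · have : 0 ≤ 1 - x := by linarith
      positivity
    · have h2 : (1 - x) * ((1 - x) ^ j - (1 - j * x)) ≤ j ^ 2 * x ^ 2 := by nlinarith
      push_cast
      nlinarith [sq_nonneg x, mul_nonneg hj (sq_nonneg x)]

theorem one_add_pow_le_two {x : ℝ} (hx : 0 ≤ x) {m : ℕ} (hm : m * x ≤ 1 / 2) :
    (1 + x) ^ m ≤ 2 := by
  calc _ ≤ Real.exp x ^ m := by
        gcongr; rw [add_comm]; exact Real.add_one_le_exp _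
    _ = Real.exp (m * x) := by rw [← Real.exp_nat_mul]
    _ ≤ Real.exp (Real.log 2) := by
        gcongr; linarith [Real.log_two_gt_d9]
    _ = 2 := Real.exp_log two_pos

/-! ### Error propagation through steps and rounds. -/

section Step

variable {α ι : Type} [DecidableEq α] {edge : ι → Finset α} {E : Finset ι}
  {X : Finset α} {K D : ℕ} {δ : ℝ}

/-- An edge meeting `S` once gives `|S ∪ e| = j + K - 1`, and such edges have total weight about `j
* η`. The old error thus grows by a factor `1 + j * η * B ≤ (1 + η * B) ^ j`, absorbed into the
base. The other errors are of order `j ^ 2 * η * (δ + η)`, and `j ^ 2 ≤ 2 * 2 ^ j` moves them into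
`h`. -/
theorem NearlyLinear.greedyStep_error (H : NearlyLinear edge E X K D δ) (hδ : 0 ≤ δ)
    (hK : 1 ≤ K) (hE : E.Nonempty) {η : ℝ} (hη : η = D / E.card) (hη1 : η ≤ 1)
    {a : Finset α → ℝ} (ha : ∀ S, 0 ≤ a S ∧ a S ≤ 1) {p h q B : ℝ} (hp0 : 0 ≤ p) (hp1 : p ≤ 1)
    (hh : 0 ≤ h) (hq : 2 ≤ q) (hB : q ^ (K - 1) ≤ B)
    (hap : ∀ S ⊆ X, |a S - p ^ S.card| ≤ h * q ^ S.card) (S : Finset α) (hS : S ⊆ X) :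
    |greedyStep edge E a S - (p - η * p ^ K) ^ S.card| ≤
      (h + 2 * (η * (2 * δ + η))) * (q * (1 + η * B)) ^ S.card := by
  obtain ⟨L, rfl⟩ : ∃ L, K = L + 1 := ⟨K - 1, by omega⟩
  rw [Nat.add_sub_cancel] at hB
  set j := S.card with hj
  have hc : (0 : ℝ) < E.card := by exact_mod_cast hE.card_pos
  have hη0 : 0 ≤ η := by rw [hη]; positivity
  have hq0 : (0 : ℝ) ≤ q := by linarith
  have hB0 : 0 ≤ B := le_trans (by positivity) hB
  have hsum := H.abs_sum_sub_le hδ hS (f := fun e => a (S ∪ edge e)) (y := p ^ (j + L))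
    (z := h * q ^ (j + L)) (fun e => (ha _).1) (fun e => (ha _).2) (by positivity)
    (pow_le_one₀ hp0 hp1) (by positivity) (by
      intro e he h1
      have hcard : (S ∪ edge e).card = j + L := by
        have := Finset.card_union_add_card_inter (edge e) S
        rw [H.uniform e he, h1] at this
        rw [Finset.union_comm]; omega
      have := hap (S ∪ edge e) (Finset.union_subset hS (H.subset e he))
      rwa [hcard] at this)
  rw [← hj] at hsum
  have hsum2 : |(E.card : ℝ)⁻¹ * (∑ e ∈ E with ¬ Disjoint (edge e) S, a (S ∪ edge e))
      - j * (η * p ^ (j + L))| ≤ j * (η * (h * q ^ (j + L))) + 2 * (j ^ 2 * (δ * η)) := by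
    have e1 : (E.card : ℝ)⁻¹ * (∑ e ∈ E with ¬ Disjoint (edge e) S, a (S ∪ edge e))
      - j * (η * p ^ (j + L)) = (E.card : ℝ)⁻¹ *
        ((∑ e ∈ E with ¬ Disjoint (edge e) S, a (S ∪ edge e)) - j * D * p ^ (j + L)) := by
      rw [hη]; field_simp
    have e2 : j * (η * (h * q ^ (j + L))) + 2 * (j ^ 2 * (δ * η)) = (E.card : ℝ)⁻¹ *
        (j * D * (h * q ^ (j + L)) + 2 * ((j : ℝ) ^ 2 * (δ * D))) := by
      rw [hη]; field_simp
    rw [e1, e2, abs_mul, abs_of_pos (inv_pos.2 hc)]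
    exact mul_le_mul_of_nonneg_left hsum (inv_pos.2 hc).le
  have hpL0 : 0 ≤ p ^ L := by positivity
  have hpL1 : p ^ L ≤ 1 := pow_le_one₀ hp0 hp1
  have hpow : |(p - η * p ^ (L + 1)) ^ j - (p ^ j - j * (η * p ^ (j + L)))| ≤ j ^ 2 * η ^ 2 := by
    have e1 : p - η * p ^ (L + 1) = p * (1 - η * p ^ L) := by ring
    obtain ⟨b0, b1⟩ := one_sub_pow_bounds (x := η * p ^ L) (by positivity)
      (mul_le_one₀ hη1 hpL0 hpL1) j
    have e2 : (p * (1 - η * p ^ L)) ^ j - (p ^ j - j * (η * p ^ (j + L))) =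
        p ^ j * ((1 - η * p ^ L) ^ j - (1 - j * (η * p ^ L))) := by
      rw [mul_pow, pow_add]; ring
    have hpj0 : 0 ≤ p ^ j := by positivity
    have hpj1 : p ^ j ≤ 1 := pow_le_one₀ hp0 hp1
    rw [e1, e2, abs_of_nonneg (mul_nonneg hpj0 b0)]
    have h1 : (η * p ^ L) ^ 2 ≤ η ^ 2 := by
      gcongr
      exact mul_le_of_le_one_right hη0 hpL1
    calc _ ≤ 1 * ((j : ℝ) ^ 2 * (η * p ^ L) ^ 2) := mul_le_mul hpj1 b1 b0 zero_le_one
      _ ≤ _ := by rw [one_mul]; gcongr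
  have hS' := hap S hS
  rw [← hj] at hS'
  rw [greedyStep_apply]
  have htri : |a S - (E.card : ℝ)⁻¹ * (∑ e ∈ E with ¬ Disjoint (edge e) S, a (S ∪ edge e))
      - (p - η * p ^ (L + 1)) ^ j| ≤ h * q ^ j + (j * (η * (h * q ^ (j + L)))
        + 2 * (j ^ 2 * (δ * η))) + j ^ 2 * η ^ 2 := by
    rw [abs_le] at *
    constructor <;> linarith [hS'.1, hS'.2, hsum2.1, hsum2.2, hpow.1, hpow.2]
  refine htri.trans ?_
  have hx : 1 + (j : ℝ) * (η * B) ≤ (1 + η * B) ^ j :=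
    one_add_mul_le_pow (by have := mul_nonneg hη0 hB0; linarith) j
  have hmain : h * q ^ j + j * (η * (h * q ^ (j + L))) ≤ h * (q * (1 + η * B)) ^ j := by
    calc _ = h * q ^ j * (1 + j * (η * q ^ L)) := by rw [pow_add]; ring
      _ ≤ h * q ^ j * (1 + j * (η * B)) := by gcongr
      _ ≤ h * q ^ j * (1 + η * B) ^ j := by gcongr
      _ = _ := by rw [mul_pow]; ring
  have hj2 : (j : ℝ) ^ 2 ≤ 2 * (q * (1 + η * B)) ^ j := by
    have h1 : (j : ℝ) ^ 2 ≤ 2 * 2 ^ j := by exact_mod_cast sq_le_two_mul_two_pow j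
    refine h1.trans ?_
    gcongr
    nlinarith [mul_nonneg hq0 (mul_nonneg hη0 hB0)]
  have : 0 ≤ η * (2 * δ + η) := by positivity
  nlinarith [mul_le_mul_of_nonneg_right hj2 this]

/-- Avoidance probabilities after `k` greedy steps. -/
noncomputable def greedyAvoidance (edge : ι → Finset α) (E : Finset ι) (k : ℕ) :
    Finset α → ℝ :=
  (greedyStep edge E)^[k] fun _ => 1

theorem greedyAvoidance_mem (hE : E.Nonempty) (k : ℕ) :
    greedyAvoidance edge E k ∈ avoidanceHull edge E := by
  induction k with
  | zero => exact one_mem_avoidanceHull edge E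
  | succ k ih =>
    rw [greedyAvoidance, Function.iterate_succ_apply']
    exact greedyStep_mem_avoidanceHull edge E hE ih

/-- The bound on `m` keeps the base between 2 and 4, which justifies `B = 4 ^ (K - 1)`. -/
theorem NearlyLinear.greedyAvoidance_steps (H : NearlyLinear edge E X K D δ) (hδ : 0 ≤ δ)
    (hK : 1 ≤ K) (hE : E.Nonempty) {η : ℝ} (hη : η = D / E.card) (hη1 : η ≤ 1) {h : ℝ}
    (hh : 0 ≤ h) (k : ℕ) (hk : ∀ S ⊆ X,
      |greedyAvoidance edge E k S - uncoveredDensity K η k ^ S.card| ≤ h * 2 ^ S.card)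
    (m : ℕ) (hm : m * (η * 4 ^ (K - 1)) ≤ 1 / 2) : ∀ S ⊆ X,
      |greedyAvoidance edge E (k + m) S - uncoveredDensity K η (k + m) ^ S.card| ≤
        (h + m * (2 * (η * (2 * δ + η)))) * (2 * (1 + η * 4 ^ (K - 1)) ^ m) ^ S.card := by
  have hη0 : 0 ≤ η := by rw [hη]; positivity
  induction m with
  | zero => simpa using hk
  | succ m ih =>
    have hB0 : 0 ≤ η * 4 ^ (K - 1) := by positivity
    have hm' : m * (η * 4 ^ (K - 1)) ≤ 1 / 2 := by push_cast at hm; linarith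
    intro S hS
    have hpow1 : 1 ≤ (1 + η * 4 ^ (K - 1)) ^ m := one_le_pow₀ (by linarith)
    have hpow2 := one_add_pow_le_two hB0 hm'
    obtain ⟨b0, b1⟩ := uncoveredDensity_bounds hK hη0 hη1 (k + m)
    have := H.greedyStep_error hδ hK hE hη hη1
      (avoidanceHull_bounds edge E (greedyAvoidance_mem hE (k + m))) b0 b1
      (h := h + m * (2 * (η * (2 * δ + η))))
      (q := 2 * (1 + η * 4 ^ (K - 1)) ^ m) (B := 4 ^ (K - 1)) (by positivity) (by linarith)
      (pow_le_pow_left₀ (by positivity) (by linarith) (K - 1)) (ih hm') S hS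
    rw [← add_assoc, greedyAvoidance, Function.iterate_succ_apply', uncoveredDensity]
    refine this.trans (le_of_eq ?_)
    push_cast
    ring

/-- The error is at most 1 and at most `h' * 4 ^ |S|`, hence at most the square root of the latter,
`√h' * 2 ^ |S|`. This restores base 2 for the next round. -/
theorem NearlyLinear.greedyAvoidance_round (H : NearlyLinear edge E X K D δ) (hδ : 0 ≤ δ)
    (hK : 1 ≤ K) (hE : E.Nonempty) {η : ℝ} (hη : η = D / E.card) (hη1 : η ≤ 1) {h : ℝ}
    (hh : 0 ≤ h) (k : ℕ) (hk : ∀ S ⊆ X,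
      |greedyAvoidance edge E k S - uncoveredDensity K η k ^ S.card| ≤ h * 2 ^ S.card)
    (m : ℕ) (hm : m * (η * 4 ^ (K - 1)) ≤ 1 / 2) : ∀ S ⊆ X,
      |greedyAvoidance edge E (k + m) S - uncoveredDensity K η (k + m) ^ S.card| ≤
        √(h + (2 * δ + η)) * 2 ^ S.card := by
  intro S hS
  have hη0 : 0 ≤ η := by rw [hη]; positivity
  have hB0 : 0 ≤ η * 4 ^ (K - 1) := by positivity
  have hpow2 := one_add_pow_le_two hB0 hm
  have hmη : 2 * (m * η) ≤ 1 := by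
    have : (1 : ℝ) ≤ 4 ^ (K - 1) := one_le_pow₀ (by norm_num)
    have : (m : ℝ) * η ≤ m * (η * 4 ^ (K - 1)) := by
      gcongr; exact le_mul_of_one_le_right hη0 this
    linarith
  have h1 := H.greedyAvoidance_steps hδ hK hE hη hη1 hh k hk m hm S hS
  set err := |greedyAvoidance edge E (k + m) S - uncoveredDensity K η (k + m) ^ S.card| with herr
  have h2 : err ≤ (h + (2 * δ + η)) * 4 ^ S.card := by
    refine h1.trans ?_
    gcongr
    · nlinarith
    · linarith
  have h3 : err ≤ 1 := by
    obtain ⟨a0, a1⟩ := avoidanceHull_bounds edge E (greedyAvoidance_mem hE (k + m)) S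
    obtain ⟨b0, b1⟩ := uncoveredDensity_bounds hK hη0 hη1 (k + m)
    have c0 : 0 ≤ uncoveredDensity K η (k + m) ^ S.card := by positivity
    have c1 : uncoveredDensity K η (k + m) ^ S.card ≤ 1 := pow_le_one₀ b0 b1
    rw [herr, abs_le]
    constructor <;> linarith
  have h4 : √(h + (2 * δ + η)) * 2 ^ S.card = √((h + (2 * δ + η)) * 4 ^ S.card) := by
    rw [Real.sqrt_mul (by positivity)]
    congr 1
    rw [show (4 : ℝ) = 2 ^ 2 by norm_num, ← pow_mul, mul_comm, pow_mul,
      Real.sqrt_sq (by positivity)]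
  rw [h4]
  refine Real.le_sqrt_of_sq_le ?_
  have : 0 ≤ err := abs_nonneg _
  nlinarith

end Step

/-! ### Almost perfect packings. -/

/-- Error bound after `r` rounds. -/
noncomputable def roundError (x : ℝ) : ℕ → ℝ
  | 0 => 0
  | r + 1 => √(roundError x r + x)

theorem roundError_nonneg (x : ℝ) (r : ℕ) : 0 ≤ roundError x r := by
  cases r with
  | zero => exact le_rfl
  | succ r => exact Real.sqrt_nonneg _

theorem tendsto_roundError (r : ℕ) : Tendsto (fun x => roundError x r) (𝓝 0) (𝓝 0) := by
  induction r with
  | zero => exact tendsto_const_nhds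
  | succ r ih =>
    have := (ih.add tendsto_id).sqrt
    simpa [roundError] using this

theorem exists_almost_perfect_packing (K : ℕ) (hK : 1 ≤ K) {ε : ℝ} (hε : 0 < ε) :
    ∃ γ : ℝ, 0 < γ ∧ ∀ {α ι : Type} [DecidableEq α] (edge : ι → Finset α) (E : Finset ι)
      (X : Finset α) (D : ℕ) (δ : ℝ), NearlyLinear edge E X K D δ → E.Nonempty → 0 < D →
      0 ≤ δ → 2 * δ + D / E.card ≤ γ →
      ∃ P ∈ packings edge E, (1 - ε) * X.card ≤ K * P.card := by
  set B : ℝ := 4 ^ (K - 1) with hB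
  have hB0 : 0 < B := by positivity
  have hB1 : 1 ≤ B := one_le_pow₀ (by norm_num)
  -- A round gains at least `(ε / 2) ^ K / (4 * B)` in density while it exceeds `ε / 2`, so the
  -- number of rounds does not depend on the hypergraph.
  obtain ⟨r, hr⟩ : ∃ r : ℕ, 4 * B / (ε / 2) ^ K ≤ r := exists_nat_ge _
  -- On singletons the error is doubled by `2 ^ 1`, leaving `ε / 2` for the density.
  have hev : ∀ᶠ x in 𝓝[>] (0 : ℝ), roundError x r < ε / 4 :=
    ((tendsto_roundError r).mono_left nhdsWithin_le_nhds).eventually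
      (gt_mem_nhds (by positivity))
  obtain ⟨u, hu0, hu⟩ := mem_nhdsGT_iff_exists_Ioc_subset.1 hev
  refine ⟨min u (1 / (4 * B)), lt_min hu0 (by positivity), ?_⟩
  intro α ι _ edge E X D δ H hE hD hδ hγ
  have hc : (0 : ℝ) < E.card := by exact_mod_cast hE.card_pos
  obtain ⟨η, hη⟩ : ∃ η : ℝ, η = D / E.card := ⟨_, rfl⟩
  rw [← hη] at hγ
  have hη0 : 0 < η := by rw [hη]; positivity
  have hη4 : η ≤ 1 / (4 * B) := by linarith [min_le_right u (1 / (4 * B))]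
  have hη4' : η * (4 * B) ≤ 1 := by rwa [le_div_iff₀ (by positivity)] at hη4
  have hη1 : η ≤ 1 := by nlinarith
  have hxu : roundError (2 * δ + η) r < ε / 4 :=
    hu ⟨by positivity, hγ.trans (min_le_left _ _)⟩
  set m := ⌊1 / (2 * (η * B))⌋₊ with hm
  have hm1 : m * (η * B) ≤ 1 / 2 := by
    have := Nat.floor_le (a := 1 / (2 * (η * B))) (by positivity)
    rw [← hm, le_div_iff₀ (by positivity)] at this
    linarith
  -- Rounding down costs at most half, since `4 * η * B ≤ 1`.
  have hm2 : 1 ≤ m * (η * (4 * B)) := by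
    have := Nat.lt_floor_add_one (1 / (2 * (η * B)))
    rw [← hm, div_lt_iff₀ (by positivity)] at this
    nlinarith
  have hround : ∀ i : ℕ, ∀ S ⊆ X,
      |greedyAvoidance edge E (i * m) S - uncoveredDensity K η (i * m) ^ S.card| ≤
        roundError (2 * δ + η) i * 2 ^ S.card := by
    intro i
    induction i with
    | zero => intro S _; simp [greedyAvoidance, uncoveredDensity, roundError]
    | succ i ih =>
      rw [Nat.succ_mul]
      exact H.greedyAvoidance_round hδ hK hE hη hη1 (roundError_nonneg _ _) _ ih m hm1
  have hdens : uncoveredDensity K η (r * m) ≤ ε / 2 := by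
    rcases uncoveredDensity_le hK hη0.le hη1 (half_pos hε).le (r * m) with h | h
    · exact h
    · have h1 : 4 * B ≤ r * (ε / 2) ^ K := by rwa [div_le_iff₀ (by positivity)] at hr
      have h2 : 1 ≤ ((r * m : ℕ) : ℝ) * (η * (ε / 2) ^ K) := by
        push_cast
        calc (1 : ℝ) ≤ m * (η * (4 * B)) := hm2
          _ ≤ m * (η * (r * (ε / 2) ^ K)) := by gcongr
          _ = _ := by ring
      linarith
  obtain ⟨P, hP, hsum⟩ := exists_packing_sum_le edge E (greedyAvoidance_mem hE (r * m)) X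
  refine ⟨P, hP, ?_⟩
  have hup : ∑ v ∈ X, greedyAvoidance edge E (r * m) {v} ≤ X.card * ε := by
    rw [← nsmul_eq_mul]
    refine Finset.sum_le_card_nsmul _ _ _ fun v hv => ?_
    have := (abs_le.1 (hround r {v} (Finset.singleton_subset_iff.2 hv))).2
    rw [Finset.card_singleton, pow_one, pow_one] at this
    linarith
  have hmiss : ∑ v ∈ X, missIndicator edge P {v} = X.card - K * P.card := by
    have h1 : (P.biUnion edge).card = P.card * K := by
      rw [Finset.card_biUnion hP.2, Finset.sum_const_nat fun e he => H.uniform e (hP.1 he)]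
    have h2 : P.biUnion edge ⊆ X := Finset.biUnion_subset.2 fun e he => H.subset e (hP.1 he)
    have h3 : ∑ v ∈ X, missIndicator edge P {v} = ((X \ P.biUnion edge).card : ℝ) := by
      rw [← Finset.filter_notMem_eq_sdiff, ← Finset.sum_boole]
      simp only [missIndicator, Finset.disjoint_singleton_left]
    rw [h3, Finset.cast_card_sdiff h2, h1]
    push_cast; ring
  linarith

/-! ### Partial Steiner systems. -/

theorem choose_mono_of_le_half {n i j : ℕ} (hij : i ≤ j) (hj : 2 * j ≤ n) :
    n.choose i ≤ n.choose j := by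
  induction j, hij using Nat.le_induction with
  | base => exact le_rfl
  | succ j _ ih =>
    exact (ih (by omega)).trans (Nat.choose_le_succ_of_lt_half_left (by omega))

/-- The `t`-subsets of an `n`-set, viewed as edges on the set of `r`-subsets. -/
theorem nearlyLinear_powersetCard {n r t : ℕ} (hrt : r ≤ t) (hrn : r < n) :
    NearlyLinear (fun e : Finset (Fin n) => e.powersetCard r)
      (Finset.univ.powersetCard t) (Finset.univ.powersetCard r)
      (t.choose r) ((n - r).choose (t - r)) (((t - r : ℕ) : ℝ) / ((n - r : ℕ) : ℝ)) where
  subset e _ := Finset.powersetCard_mono (Finset.subset_univ e)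
  uniform e he := by
    rw [Finset.card_powersetCard, (Finset.mem_powersetCard.1 he).2]
  regular v hv := by
    have hv' := (Finset.mem_powersetCard.1 hv).2
    have := Finset.card_filter_powersetCard_subset v Finset.univ t (Finset.subset_univ v)
      (by omega)
    simpa [Finset.mem_powersetCard, hv'] using this
  codegree u hu v hv huv := by
    have hu' := (Finset.mem_powersetCard.1 hu).2
    have hv' := (Finset.mem_powersetCard.1 hv).2
    -- Edges containing `u` and `v` contain the `(r+1)`-set `insert x u`; the ratio of the two
    -- binomials is `(t - r) / (n - r)`.
    obtain ⟨x, hxv, hxu⟩ : ∃ x ∈ v, x ∉ u := by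
      by_contra! h
      exact huv (Finset.eq_of_subset_of_card_le h (by omega)).symm
    have hnr : (0 : ℝ) < ((n - r : ℕ) : ℝ) := by exact_mod_cast Nat.sub_pos_of_lt hrn
    have hc : (insert x u).card = r + 1 := by rw [Finset.card_insert_of_notMem hxu, hu']
    have hsub : ((Finset.univ.powersetCard t).filter fun e : Finset (Fin n) =>
        u ∈ e.powersetCard r ∧ v ∈ e.powersetCard r) ⊆
        (Finset.univ.powersetCard t).filter (insert x u ⊆ ·) := by
      intro e he
      simp only [Finset.mem_filter, Finset.mem_powersetCard] at he ⊢
      exact ⟨he.1, Finset.insert_subset (he.2.2.1 hxv) he.2.1.1⟩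
    have hle := Finset.card_le_card hsub
    rcases hrt.eq_or_lt with rfl | hlt
    · have h0 : (Finset.univ.powersetCard r).filter (insert x u ⊆ ·) = ∅ := by
        refine Finset.filter_eq_empty_iff.2 fun e he hs => ?_
        have h1 := Finset.card_le_card hs
        rw [hc, (Finset.mem_powersetCard.1 he).2] at h1
        omega
      rw [h0, Finset.card_empty, Nat.le_zero] at hle
      rw [hle]
      simp
    · rw [Finset.card_filter_powersetCard_subset _ _ _ (Finset.subset_univ _) (by omega), hc,
        Finset.card_univ, Fintype.card_fin] at hle
      have h2 := Nat.add_one_mul_choose_eq (n - (r + 1)) (t - (r + 1))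
      rw [show n - (r + 1) + 1 = n - r by omega, show t - (r + 1) + 1 = t - r by omega] at h2
      rw [div_mul_eq_mul_div, le_div_iff₀ hnr]
      have h3 := Nat.mul_le_mul_right (n - r) hle
      rw [mul_comm _ (n - r), mul_comm _ (n - r), h2, mul_comm _ (t - r)] at h3
      rw [mul_comm]
      exact_mod_cast h3

theorem disjoint_powersetCard_iff {β : Type} [DecidableEq β] {e f : Finset β} {r : ℕ} :
    Disjoint (e.powersetCard r) (f.powersetCard r) ↔ (e ∩ f).card < r := by
  rw [← not_iff_not, not_lt, Finset.not_disjoint_iff]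
  constructor
  · rintro ⟨u, hu, hv⟩
    rw [Finset.mem_powersetCard] at hu hv
    rw [← hu.2]
    exact Finset.card_le_card (Finset.subset_inter hu.1 hv.1)
  · intro h
    obtain ⟨u, hu, hc⟩ := Finset.exists_subset_card_eq h
    have := Finset.subset_inter_iff.1 hu
    exact ⟨u, Finset.mem_powersetCard.2 ⟨this.1, hc⟩, Finset.mem_powersetCard.2 ⟨this.2, hc⟩⟩

/-- Rödl's theorem: asymptotically optimal partial Steiner systems exist. -/
theorem exists_partial_steiner_system {r t : ℕ} (hr : 1 ≤ r) (hrt : r ≤ t) {ε : ℝ}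
    (hε : 0 < ε) : ∀ᶠ n : ℕ in atTop,
      ∃ P ∈ packings (fun e : Finset (Fin n) => e.powersetCard r) (Finset.univ.powersetCard t),
        (1 - ε) * n.choose r ≤ t.choose r * P.card := by
  obtain ⟨γ, hγ, key⟩ := exists_almost_perfect_packing (t.choose r) (Nat.choose_pos hrt) hε
  have hT : Tendsto (fun n : ℕ => 2 * (((t - r : ℕ) : ℝ) / ((n - r : ℕ) : ℝ)) +
      (t.choose r : ℝ) / n) atTop (𝓝 (2 * 0 + 0)) := by
    have h1 : Tendsto (fun n : ℕ => ((n - r : ℕ) : ℝ)) atTop atTop :=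
      tendsto_natCast_atTop_atTop.comp (tendsto_sub_atTop_nat r)
    exact ((tendsto_const_nhds.div_atTop h1).const_mul 2).add
      (tendsto_const_nhds.div_atTop tendsto_natCast_atTop_atTop)
  rw [mul_zero, add_zero] at hT
  filter_upwards [hT.eventually (gt_mem_nhds hγ), eventually_ge_atTop (2 * t)] with n hn hnt
  have hD : 0 < (n - r).choose (t - r) := Nat.choose_pos (by omega)
  have hE : (0 : ℝ) < n.choose t := by exact_mod_cast Nat.choose_pos (by omega)
  have hn0 : (0 : ℝ) < n := by exact_mod_cast (by omega : 0 < n)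
  have hEne : (Finset.univ.powersetCard t : Finset (Finset (Fin n))).Nonempty :=
    Finset.powersetCard_nonempty.2 (by simp; omega)
  obtain ⟨P, hP, h⟩ := key _ _ _ _ _ (nearlyLinear_powersetCard (n := n) hrt (by omega)) hEne hD
    (by positivity) (by
      refine le_trans (add_le_add le_rfl ?_) hn.le
      rw [Finset.card_powersetCard, Finset.card_univ, Fintype.card_fin,
        div_le_div_iff₀ hE hn0]
      -- Here `D / |E| = t.choose r / n.choose r`, and `n ≤ n.choose r` because `1 ≤ r`.
      have h1 := Nat.choose_mul (n := n) hrt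
      have h2 : n ≤ n.choose r := by
        simpa using choose_mono_of_le_half (n := n) hr (by omega)
      have h3 : (n - r).choose (t - r) * n ≤ t.choose r * n.choose t := by
        rw [mul_comm (t.choose r), h1, mul_comm]
        exact Nat.mul_le_mul_right _ h2
      exact_mod_cast h3)
  refine ⟨P, hP, ?_⟩
  simpa [Finset.card_powersetCard] using h

theorem packing_card_le {n r t : ℕ} {P : Finset (Finset (Fin n))}
    (hP : P ∈ packings (fun e : Finset (Fin n) => e.powersetCard r)
      (Finset.univ.powersetCard t)) : t.choose r * P.card ≤ n.choose r := by
  have h1 : (P.biUnion fun e => e.powersetCard r).card = P.card * t.choose r := by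
    rw [Finset.card_biUnion hP.2, Finset.sum_const_nat fun e he => ?_]
    rw [Finset.card_powersetCard, (Finset.mem_powersetCard.1 (hP.1 he)).2]
  have h2 : (P.biUnion fun e => e.powersetCard r) ⊆ Finset.univ.powersetCard r :=
    Finset.biUnion_subset.2 fun e _ => Finset.powersetCard_mono (Finset.subset_univ e)
  have h3 := Finset.card_le_card h2
  rw [h1] at h3
  simpa [Finset.card_powersetCard, mul_comm] using h3

/-! ### From packings to binary vectors. -/

/-- The characteristic vector of a set. -/
def charVector {n : ℕ} (e : Finset (Fin n)) : Fin n → Bool := fun i => decide (i ∈ e)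

theorem charVector_injective {n : ℕ} : Function.Injective (charVector (n := n)) := by
  intro e f h
  ext i
  simpa [charVector] using congrFun h i

theorem hammingDist_charVector {n : ℕ} (e f : Finset (Fin n)) :
    hammingDist (charVector e) (charVector f) + 2 * (e ∩ f).card = e.card + f.card := by
  have h : hammingDist (charVector e) (charVector f) = ((e \ f) ∪ (f \ e)).card := by
    unfold hammingDist charVector
    congr 1
    ext i
    by_cases h1 : i ∈ e <;> by_cases h2 : i ∈ f <;> simp [h1, h2]
  rw [h, Finset.card_union_of_disjoint (disjoint_sdiff_sdiff)]
  have h1 := Finset.card_sdiff_add_card_inter e f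
  have h2 := Finset.card_sdiff_add_card_inter f e
  rw [Finset.inter_comm f e] at h2
  omega

theorem hasDistancesIn_image_charVector {n s t : ℕ} (hst : s < t) {P : Finset (Finset (Fin n))}
    (hP : P ∈ packings (fun e : Finset (Fin n) => e.powersetCard (t - s))
      (Finset.univ.powersetCard t)) :
    HasDistancesIn (P.image charVector) (Set.Icc (2 * s + 1) (2 * t)) := by
  intro x hx y hy hxy
  obtain ⟨e, he, rfl⟩ := Finset.mem_image.1 hx
  obtain ⟨f, hf, rfl⟩ := Finset.mem_image.1 hy
  have hef : e ≠ f := fun h => hxy (by rw [h])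
  have h1 := disjoint_powersetCard_iff.1 (hP.2 he hf hef)
  have h2 := hammingDist_charVector e f
  rw [(Finset.mem_powersetCard.1 (hP.1 he)).2, (Finset.mem_powersetCard.1 (hP.1 hf)).2] at h2
  rw [Set.mem_Icc]
  omega

theorem exists_max_packing {α ι : Type} (edge : ι → Finset α) (E : Finset ι) :
    ∃ P ∈ packings edge E, ∀ Q ∈ packings edge E, Q.card ≤ P.card := by
  classical
  have hne : (E.powerset.filter (· ∈ packings edge E)).Nonempty :=
    ⟨∅, Finset.mem_filter.2 ⟨Finset.empty_mem_powerset E, by simp [packings]⟩⟩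
  obtain ⟨P, hP, hmax⟩ := Finset.exists_max_image _ Finset.card hne
  refine ⟨P, (Finset.mem_filter.1 hP).2, fun Q hQ => hmax Q ?_⟩
  exact Finset.mem_filter.2 ⟨Finset.mem_powerset.2 hQ.1, hQ⟩

theorem mainTheorem7 (s t : ℕ) (hst : s < t) :
    ∃ (ε : ℕ → ℝ) (c : ℝ), Tendsto ε atTop (𝓝 0) ∧ 0 < c ∧
      ∀ᶠ n : ℕ in atTop, ∃ F : Finset (Fin n → Bool),
        HasDistancesIn F (Set.Icc (2 * s + 1) (2 * t)) ∧
        (F.card : ℝ) = (1 / (t.choose s : ℝ) - ε n) * (n.choose (t - s) : ℝ) ∧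
        c * ((n.choose (t - s) : ℝ) + 2 * ∑ i ∈ Finset.range (t - s), (n.choose i : ℝ))
          ≤ (F.card : ℝ) := by
  -- Maximum packings do not depend on `ε`, so a single sequence satisfies the lower bound for every
  -- `ε`.
  choose P hP hmax using fun n : ℕ => exists_max_packing
    (fun e : Finset (Fin n) => e.powersetCard (t - s)) (Finset.univ.powersetCard t)
  have hsymm : t.choose (t - s) = t.choose s := Nat.choose_symm hst.le
  have hK : (0 : ℝ) < t.choose s := by exact_mod_cast Nat.choose_pos hst.le
  have hlow : ∀ ε : ℝ, 0 < ε → ∀ᶠ n : ℕ in atTop,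
      (1 - ε) * n.choose (t - s) ≤ t.choose s * (P n).card := by
    intro ε hε
    filter_upwards [exists_partial_steiner_system (r := t - s) (t := t) (by omega) (by omega) hε]
      with n hn
    obtain ⟨Q, hQ, h⟩ := hn
    rw [hsymm] at h
    refine h.trans ?_
    have : (Q.card : ℝ) ≤ (P n).card := by exact_mod_cast hmax n Q hQ
    exact mul_le_mul_of_nonneg_left this hK.le
  have hN : ∀ n : ℕ, 2 * t ≤ n → (0 : ℝ) < n.choose (t - s) := fun n hn => by
    exact_mod_cast Nat.choose_pos (by omega)
  -- The error term is defined to make the size exact. For `c`, the packing has at least half the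
  -- ideal size, and each of the `t - s` lower binomials is at most `n.choose (t - s)`.
  refine ⟨fun n => 1 / t.choose s - (P n).card / n.choose (t - s),
    1 / (2 * t.choose s * (1 + 2 * (t - s : ℕ))), ?_, by positivity, ?_⟩
  · rw [Metric.tendsto_nhds]
    intro ε hε
    filter_upwards [hlow (ε / 2) (by positivity), eventually_ge_atTop (2 * t)] with n hn hnt
    have hN' := hN n hnt
    have hup : (t.choose s : ℝ) * (P n).card ≤ n.choose (t - s) := by
      have := packing_card_le (hP n)
      rw [hsymm] at this
      exact_mod_cast this
    have hK1 : (1 : ℝ) ≤ t.choose s := by exact_mod_cast Nat.choose_pos hst.le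
    have e : (1 : ℝ) / t.choose s - (P n).card / n.choose (t - s) =
        (n.choose (t - s) - t.choose s * (P n).card) / (t.choose s * n.choose (t - s)) := by
      field_simp
    rw [Real.dist_eq, sub_zero, e, abs_of_nonneg (div_nonneg (by linarith) (by positivity)),
      div_lt_iff₀ (by positivity)]
    have : ε * n.choose (t - s) ≤ ε * (t.choose s * n.choose (t - s)) := by
      gcongr
      exact le_mul_of_one_le_left hN'.le hK1
    nlinarith [mul_pos hε hN']
  · filter_upwards [hlow (1 / 2) (by norm_num), eventually_ge_atTop (2 * t)] with n hn hnt
    have hN' := hN n hnt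
    refine ⟨(P n).image charVector, hasDistancesIn_image_charVector hst (hP n), ?_, ?_⟩
    · rw [Finset.card_image_of_injective _ charVector_injective]
      field_simp
      ring
    · rw [Finset.card_image_of_injective _ charVector_injective]
      have hsum : ∑ i ∈ Finset.range (t - s), (n.choose i : ℝ) ≤
          (t - s : ℕ) * n.choose (t - s) := by
        have := Finset.sum_le_card_nsmul (Finset.range (t - s)) (fun i => (n.choose i : ℝ))
          (n.choose (t - s)) fun i hi => by
            exact_mod_cast choose_mono_of_le_half (Finset.mem_range.1 hi).le (by omega)
        simpa using this
      rw [div_mul_eq_mul_div, one_mul, div_le_iff₀ (by positivity)]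
      have h1 : (0 : ℝ) ≤ (t - s : ℕ) := by positivity
      calc _ ≤ (1 + 2 * ((t - s : ℕ) : ℝ)) * n.choose (t - s) := by linarith
        _ ≤ (1 + 2 * ((t - s : ℕ) : ℝ)) * (2 * (t.choose s * (P n).card)) := by
            gcongr; linarith
        _ = _ := by ring
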